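/- Let $k$ be a field of characteristic $0$ and $n \ge 2$. Let $\mathcal{T}_n$ be the Lie algebra over $k$ with generators $t_{ij}$ ($1 \le i,j \le n$) and relations $t_{ij} = t_{ji}$, $t_{ii} = 0$, $[t_{ij}, t_{kl}] = 0$ when $i,j,k,l$ are pairwise distinct, and $[t_{ij}, t_{ik} + t_{kj}] = 0$. The symmetric group $\mathfrak{S}_n$ acts on it by $\sigma \cdot t_{ij} = t_{\sigma(i)\sigma(j)}$; let $\mathfrak{B}_n = k\mathfrak{S}_n \ltimes \mathsf{U}\mathcal{T}_n$ be the corresponding semidirect product, where $\mathsf{U}\mathcal{T}_n$ is the universal enveloping algebra. Let $\rho : \mathfrak{B}_n \to \mathrm{End}_k(V)$ be a representation on a finite-dimensional $k$-vector space $V$, let $\mathcal{H}_\rho = \rho(\mathcal{T}_n) \subseteq \mathfrak{gl}(V)$, and let $T = \sum_{1 \le i<j \le n} \rho(t_{ij})$. Assume that $\rho$ is semisimple and essentially pure, the latter meaning that $\rho((1\ 2))$ is a polynomial in $\rho(t_{12})$ with coefficients in $k$. Then: 1. the Lie algebra $\mathcal{H}_\rho$ is reductive, that is, its radical equals its center;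 2. $Z(\mathcal{H}_\rho) = \rho(Z(\mathcal{T}_n)) = kT$, where $Z$ denotes the center; 3. if $\operatorname{tr} \rho(t_{12}) \neq 0$, then $Z(\mathcal{H}_\rho)$ is one-dimensional; 4. if in addition $\rho$ is agregating, that is, if some $k$-linear combination of the $\rho(t_{ij})$ is diagonalizable over $k$ with pairwise distinct eigenvalues, then $\mathcal{H}_\rho$ is split over $k$: it has a Cartan subalgebra $C$ such that $\operatorname{ad} x$ is diagonalizable over $k$ on $\mathcal{H}_\rho$ for every $x \in C$. -/

import Mathlib

attribute [local instance 100] LieRing.ofAssociativeRing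

noncomputable section

namespace InfBraid

/-- The left-hand sides of the infinitesimal pure braid relations in the free Lie algebra on
symbols `t i j`: `t i j = t j i`, `t i i = 0`, `[t i j, t k l] = 0` for `i, j, k, l` pairwise
distinct, and `[t i j, t i k + t k j] = 0`. -/
inductive PureRel (k : Type*) [CommRing k] (n : ℕ) : FreeLieAlgebra k (Fin n × Fin n) → Prop
  | symm (i j : Fin n) :
      PureRel k n (FreeLieAlgebra.of k (i, j) - FreeLieAlgebra.of k (j, i))
  | diag (i : Fin n) : PureRel k n (FreeLieAlgebra.of k (i, i))
  | comm (i j l m : Fin n) (h : [i, j, l, m].Nodup) :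
      PureRel k n ⁅FreeLieAlgebra.of k (i, j), FreeLieAlgebra.of k (l, m)⁆
  | triple (i j l : Fin n) :
      PureRel k n ⁅FreeLieAlgebra.of k (i, j),
        FreeLieAlgebra.of k (i, l) + FreeLieAlgebra.of k (l, j)⁆

/-- The Lie algebra of infinitesimal pure braids on `n` strands, with scalars in `k`. -/
def PureLie (k : Type*) [CommRing k] (n : ℕ) : Type _ :=
  FreeLieAlgebra k (Fin n × Fin n) ⧸
    LieSubmodule.lieSpan k (FreeLieAlgebra k (Fin n × Fin n)) {x | PureRel k n x}

instance (k : Type*) [CommRing k] (n : ℕ) : LieRing (PureLie k n) :=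
  inferInstanceAs (LieRing (_ ⧸ LieSubmodule.lieSpan k
    (FreeLieAlgebra k (Fin n × Fin n)) {x | PureRel k n x}))

instance (k : Type*) [CommRing k] (n : ℕ) : LieAlgebra k (PureLie k n) :=
  inferInstanceAs (LieAlgebra k (_ ⧸ LieSubmodule.lieSpan k
    (FreeLieAlgebra k (Fin n × Fin n)) {x | PureRel k n x}))

variable {k : Type*} [CommRing k] {n : ℕ}

/-- The quotient map from the free Lie algebra. -/
def PureLie.mk : FreeLieAlgebra k (Fin n × Fin n) →ₗ⁅k⁆ PureLie k n where
  toFun x := LieSubmodule.Quotient.mk (N := LieSubmodule.lieSpan k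
    (FreeLieAlgebra k (Fin n × Fin n)) {x | PureRel k n x}) x
  map_add' _ _ := rfl
  map_smul' _ _ := rfl
  map_lie' := rfl

theorem PureLie.mk_surjective :
    Function.Surjective (PureLie.mk : FreeLieAlgebra k (Fin n × Fin n) →ₗ⁅k⁆ PureLie k n) :=
  LieSubmodule.Quotient.surjective_mk' _

theorem PureLie.mk_eq_zero {x : FreeLieAlgebra k (Fin n × Fin n)} (h : PureRel k n x) :
    PureLie.mk x = 0 :=
  (LieSubmodule.Quotient.mk_eq_zero'
    (N := LieSubmodule.lieSpan k (FreeLieAlgebra k (Fin n × Fin n)) {x | PureRel k n x})).2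
    (LieSubmodule.subset_lieSpan h)

variable (k) in
/-- The generator `t_{ij}` of the Lie algebra of infinitesimal pure braids. -/
def t (i j : Fin n) : PureLie k n := PureLie.mk (FreeLieAlgebra.of k (i, j))

theorem t_symm (i j : Fin n) : t k i j = t k j i := by
  have h := PureLie.mk_eq_zero (PureRel.symm (k := k) i j)
  rwa [map_sub, sub_eq_zero] at h

theorem t_diag (i : Fin n) : t k i i = 0 := PureLie.mk_eq_zero (PureRel.diag i)

theorem t_comm {i j l m : Fin n} (h : [i, j, l, m].Nodup) : ⁅t k i j, t k l m⁆ = 0 :=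
  (LieHom.map_lie _ _ _).symm.trans (PureLie.mk_eq_zero (PureRel.comm (k := k) i j l m h))

theorem t_triple (i j l : Fin n) : ⁅t k i j, t k i l + t k l j⁆ = 0 := by
  rw [t, t, t, ← map_add, ← LieHom.map_lie]
  exact PureLie.mk_eq_zero (PureRel.triple i j l)

/-- The universal property of the presentation. -/
def PureLie.lift {L : Type*} [LieRing L] [LieAlgebra k L] (f : Fin n × Fin n → L)
    (hf : ∀ x, PureRel k n x → FreeLieAlgebra.lift k f x = 0) : PureLie k n →ₗ⁅k⁆ L where
  __ := Submodule.liftQ (LieSubmodule.lieSpan k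
      (FreeLieAlgebra k (Fin n × Fin n)) {x | PureRel k n x}).toSubmodule
    (FreeLieAlgebra.lift k f : FreeLieAlgebra k (Fin n × Fin n) →ₗ[k] L) <| by
      have h : LieSubmodule.lieSpan k (FreeLieAlgebra k (Fin n × Fin n)) {x | PureRel k n x} ≤
          (FreeLieAlgebra.lift k f).ker :=
        LieSubmodule.lieSpan_le.2 fun x hx => (LieHom.mem_ker).2 (hf x hx)
      exact fun x hx => (LieHom.mem_ker).1 (h hx)
  map_lie' := by
    intro x y
    obtain ⟨x, rfl⟩ := PureLie.mk_surjective x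
    obtain ⟨y, rfl⟩ := PureLie.mk_surjective y
    exact LieHom.map_lie (FreeLieAlgebra.lift k f) x y

theorem PureLie.lift_t {L : Type*} [LieRing L] [LieAlgebra k L] (f : Fin n × Fin n → L)
    (hf : ∀ x, PureRel k n x → FreeLieAlgebra.lift k f x = 0) (i j : Fin n) :
    PureLie.lift f hf (t k i j) = f (i, j) :=
  FreeLieAlgebra.lift_of_apply f (i, j)

theorem PureLie.hom_ext {L : Type*} [LieRing L] [LieAlgebra k L] {f g : PureLie k n →ₗ⁅k⁆ L}
    (h : ∀ i j, f (t k i j) = g (t k i j)) : f = g := by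
  have h' : f.comp PureLie.mk = g.comp PureLie.mk :=
    FreeLieAlgebra.hom_ext fun x => h x.1 x.2
  ext x
  obtain ⟨x, rfl⟩ := PureLie.mk_surjective x
  exact LieHom.congr_fun h' x

/-- The action of a permutation: `σ • t_{ij} = t_{σ(i) σ(j)}`. -/
def permHom (σ : Equiv.Perm (Fin n)) : PureLie k n →ₗ⁅k⁆ PureLie k n :=
  PureLie.lift (fun p => t k (σ p.1) (σ p.2)) <| by
    intro x hx
    cases hx with
    | symm i j => simp [t_symm (σ j) (σ i)]
    | diag i => simp [t_diag]
    | comm i j l m h =>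
      simpa using t_comm (k := k) (i := σ i) (j := σ j) (l := σ l) (m := σ m)
        (by simpa using h.map σ.injective)
    | triple i j l => simpa using t_triple (k := k) (σ i) (σ j) (σ l)

@[simp]
theorem permHom_t (σ : Equiv.Perm (Fin n)) (i j : Fin n) :
    permHom σ (t k i j) = t k (σ i) (σ j) :=
  PureLie.lift_t _ _ i j

theorem permHom_one : permHom (1 : Equiv.Perm (Fin n)) = (LieHom.id : PureLie k n →ₗ⁅k⁆ _) :=
  PureLie.hom_ext fun i j => by simp

theorem permHom_mul (σ τ : Equiv.Perm (Fin n)) :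
    permHom (σ * τ) = (permHom σ : PureLie k n →ₗ⁅k⁆ _).comp (permHom τ) :=
  PureLie.hom_ext fun i j => by simp

/-- The universal enveloping algebra of the Lie algebra of infinitesimal pure braids. -/
abbrev PureEnv (k : Type*) [CommRing k] (n : ℕ) : Type _ :=
  UniversalEnvelopingAlgebra k (PureLie k n)

/-- The algebra endomorphism of the enveloping algebra induced by `permHom`. -/
def permAlgHom (σ : Equiv.Perm (Fin n)) : PureEnv k n →ₐ[k] PureEnv k n :=
  UniversalEnvelopingAlgebra.lift k ((UniversalEnvelopingAlgebra.ι k).comp (permHom σ))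

@[simp]
theorem permAlgHom_ι (σ : Equiv.Perm (Fin n)) (x : PureLie k n) :
    permAlgHom σ (UniversalEnvelopingAlgebra.ι k x) =
      UniversalEnvelopingAlgebra.ι k (permHom σ x) :=
  UniversalEnvelopingAlgebra.lift_ι_apply _ _ _

theorem permAlgHom_one :
    permAlgHom (1 : Equiv.Perm (Fin n)) = AlgHom.id k (PureEnv k n) := by
  apply UniversalEnvelopingAlgebra.hom_ext
  ext x
  exact (permAlgHom_ι 1 x).trans (by rw [permHom_one]; rfl)

theorem permAlgHom_mul (σ τ : Equiv.Perm (Fin n)) :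
    permAlgHom (σ * τ) = (permAlgHom σ : PureEnv k n →ₐ[k] _).comp (permAlgHom τ) := by
  apply UniversalEnvelopingAlgebra.hom_ext
  ext x
  refine (permAlgHom_ι _ x).trans ?_
  rw [permHom_mul]
  change _ = permAlgHom σ (permAlgHom τ (UniversalEnvelopingAlgebra.ι k x))
  rw [permAlgHom_ι, permAlgHom_ι]
  rfl

instance : MulSemiringAction (Equiv.Perm (Fin n)) (PureEnv k n) where
  smul σ u := permAlgHom σ u
  one_smul u := DFunLike.congr_fun permAlgHom_one u
  mul_smul σ τ u := DFunLike.congr_fun (permAlgHom_mul σ τ) u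
  smul_zero σ := map_zero (permAlgHom σ)
  smul_add σ := map_add (permAlgHom σ)
  smul_one σ := map_one (permAlgHom σ)
  smul_mul σ := map_mul (permAlgHom σ)

theorem perm_smul_def (σ : Equiv.Perm (Fin n)) (u : PureEnv k n) : σ • u = permAlgHom σ u := rfl

instance : SMulCommClass (Equiv.Perm (Fin n)) k (PureEnv k n) where
  smul_comm σ c u := map_smul (permAlgHom σ) c u

/-- The algebra of infinitesimal braids, the semidirect product `k 𝔖ₙ ⋉ U(𝒯ₙ)`: finite sums of
terms `u σ`, with `σ u = (σ • u) σ`. -/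
abbrev BraidAlg (k : Type*) [CommRing k] (n : ℕ) : Type _ :=
  SkewMonoidAlgebra (PureEnv k n) (Equiv.Perm (Fin n))

variable (k) in
/-- A permutation as an element of the algebra of infinitesimal braids. -/
def perm (σ : Equiv.Perm (Fin n)) : BraidAlg k n :=
  SkewMonoidAlgebra.of (PureEnv k n) (Equiv.Perm (Fin n)) σ

/-- The canonical Lie algebra morphism from the Lie algebra of infinitesimal pure braids to the
algebra of infinitesimal braids. -/
def ofPure : PureLie k n →ₗ⁅k⁆ BraidAlg k n where
  toFun x := SkewMonoidAlgebra.single 1 (UniversalEnvelopingAlgebra.ι k x)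
  map_add' x y := by rw [map_add, SkewMonoidAlgebra.single_add]
  map_smul' c x := by rw [map_smul, RingHom.id_apply, SkewMonoidAlgebra.smul_single]
  map_lie' {x y} := by
    rw [LieHom.map_lie, LieRing.of_associative_ring_bracket, LieRing.of_associative_ring_bracket,
      SkewMonoidAlgebra.single_mul_single, SkewMonoidAlgebra.single_mul_single, one_smul, one_smul,
      one_mul, sub_eq_add_neg, sub_eq_add_neg, SkewMonoidAlgebra.single_add,
      SkewMonoidAlgebra.single_neg]

variable {V : Type*} [AddCommGroup V] [Module k V]

/-- The restriction to `𝒯ₙ` of a representation of the algebra of infinitesimal braids. -/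
def restrictPure (ρ : BraidAlg k n →ₐ[k] Module.End k V) : PureLie k n →ₗ⁅k⁆ Module.End k V :=
  (ρ : BraidAlg k n →ₗ⁅k⁆ Module.End k V).comp ofPure

/-- The Lie algebra `ℋ_ρ = ρ(𝒯ₙ) ⊆ 𝔤𝔩(V)`. -/
def imageLie (ρ : BraidAlg k n →ₐ[k] Module.End k V) : LieSubalgebra k (Module.End k V) :=
  (restrictPure ρ).range

/-- Semisimplicity of a representation of an associative algebra. -/
def IsSemisimpleRep {A : Type*} [Ring A] [Algebra k A] (ρ : A →ₐ[k] Module.End k V) : Prop :=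
  @IsSemisimpleModule A _ V _ (Module.compHom V (ρ : A →+* Module.End k V))

/-- Essential purity: the transposition of the first two strands acts as a polynomial in
`t_{12}`. -/
def IsEssentiallyPure (hn : 2 ≤ n) (ρ : BraidAlg k n →ₐ[k] Module.End k V) : Prop :=
  ∃ P : Polynomial k, ρ (perm k (Equiv.swap ⟨0, by omega⟩ ⟨1, by omega⟩)) =
    Polynomial.aeval (restrictPure ρ (t k ⟨0, by omega⟩ ⟨1, by omega⟩)) P

/-- An endomorphism is regular if it is diagonalizable with distinct eigenvalues. -/
def IsRegularEnd (f : Module.End k V) : Prop :=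
  ∃ (b : Module.Basis (Fin (Module.finrank k V)) k V) (d : Fin (Module.finrank k V) → k),
    Function.Injective d ∧ ∀ i, f (b i) = d i • b i

/-- A representation is agregating if some linear combination of the `t_{ij}` acts as a regular
endomorphism. -/
def IsAgregating (ρ : BraidAlg k n →ₐ[k] Module.End k V) : Prop :=
  ∃ x ∈ Submodule.span k (Set.range fun p : Fin n × Fin n => t k p.1 p.2),
    IsRegularEnd (restrictPure ρ x)

variable (k n) in
/-- The sum of all the generators `t_{ij}`, `i < j`. -/
def sumT : PureLie k n :=
  ∑ p : Fin n × Fin n with p.1 < p.2, t k p.1 p.2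

/-- A (reductive) Lie algebra is split if it has a Cartan subalgebra all of whose elements have
a diagonalizable adjoint action over the base ring. -/
def IsSplitLie (k : Type*) [CommRing k] (L : Type*) [LieRing L] [LieAlgebra k L] : Prop :=
  ∃ C : LieSubalgebra k L, C.IsCartanSubalgebra ∧
    ∀ x ∈ C, ⨆ μ : k, (LieAlgebra.ad k L x).eigenspace μ = ⊤

end InfBraid

end

/-! Essential purity makes every permutation act by an element of the associative algebra generated
by `ρ(𝒯ₙ)`: all transpositions are conjugate to `(1 2)`, which is a polynomial in `t₁₂`. Hence
`ℋ`-submodules and `𝔅ₙ`-submodules of `V` coincide, and `V` is a faithful semisimple `ℋ`-module. In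
characteristic zero trace arguments then give reductivity and `ℋ = Z ⊕ [ℋ, ℋ]`
(`LieAlgebra.hasCentralRadical_of_complementedLattice`, `LieAlgebra.center_sup_lie_top_eq_top`).

For the center, let `z` be the central component of `ρ(t₁₂)`. Permutations act inside the algebra
generated by `ℋ`, so they commute with `z`; conjugation shows that every `ρ(tᵢⱼ)`, `i ≠ j`, has the
same central component. Thus `Z = kz`, and the central element `T` equals `n(n-1)/2 • z`
(`InfBraid.center_imageLie_le_span`).

For splitness, the Engel subalgebra of a regular element consists of diagonal matrices
(`InfBraid.isSplitLie_of_isRegularEnd`). -/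

/-! ### Lie algebras with a faithful semisimple representation -/

section SemisimpleModules

open LieModule LieAlgebra Module

/-- In characteristic zero, an endomorphism all of whose positive powers have trace zero is
nilpotent. -/
theorem Module.End.isNilpotent_of_forall_trace_mul_aeval_eq_zero {k V : Type*} [Field k]
    [CharZero k] [AddCommGroup V] [Module k V] [FiniteDimensional k V] (f : Module.End k V)
    (h : ∀ p : Polynomial k, LinearMap.trace k V (f * Polynomial.aeval f p) = 0) :
    IsNilpotent f := by
  -- Fitting decomposition: with `minpoly = X ^ a * q`, the element `u * X ^ (a + 1)` evaluates to
  -- an idempotent. The exponent `a + 1` keeps a factor `X` even when `a = 0`, so the trace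
  -- hypothesis applies.
  obtain ⟨q, hq, hX⟩ := Polynomial.exists_eq_pow_rootMultiplicity_mul_and_not_dvd
    (minpoly k f) (minpoly.ne_zero (Algebra.IsIntegral.isIntegral f)) 0
  set a := (minpoly k f).rootMultiplicity 0
  rw [map_zero, sub_zero] at hq hX
  obtain ⟨u, v, huv⟩ : IsCoprime (Polynomial.X ^ (a + 1)) q :=
    ((Polynomial.irreducible_X.coprime_iff_not_dvd).2 hX).pow_left
  have h0 : Polynomial.aeval f (Polynomial.X ^ (a + 1) * q) = 0 := by
    rw [pow_succ', mul_assoc, ← hq, map_mul, minpoly.aeval, mul_zero]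
  have he : IsIdempotentElem (Polynomial.aeval f (u * Polynomial.X ^ (a + 1))) := by
    have h1 : u * Polynomial.X ^ (a + 1) * (u * Polynomial.X ^ (a + 1)) =
        u * Polynomial.X ^ (a + 1) - u * v * (Polynomial.X ^ (a + 1) * q) := by
      linear_combination (u * Polynomial.X ^ (a + 1)) * huv
    rw [IsIdempotentElem, ← map_mul, h1, map_sub, map_mul _ (u * v), h0, mul_zero, sub_zero]
  have he0 : Polynomial.aeval f (u * Polynomial.X ^ (a + 1)) = 0 := by
    refine LinearMap.IsIdempotentElem.eq_zero_of_trace_eq_zero he ?_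
    have := h (u * Polynomial.X ^ a)
    rwa [show u * Polynomial.X ^ (a + 1) = Polynomial.X * (u * Polynomial.X ^ a) by ring,
      map_mul, Polynomial.aeval_X]
  refine ⟨a + 1, ?_⟩
  have h2 : (Polynomial.X : Polynomial k) ^ (a + 1) =
      Polynomial.X ^ (a + 1) * (u * Polynomial.X ^ (a + 1)) + v * (Polynomial.X ^ (a + 1) * q) := by
    linear_combination -(Polynomial.X ^ (a + 1)) * huv
  have h3 := congrArg (Polynomial.aeval f) h2
  rwa [map_add, map_mul _ (Polynomial.X ^ (a + 1)), map_mul _ v, he0, h0, mul_zero, mul_zero, add_zero,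
    map_pow, Polynomial.aeval_X] at h3

variable {k L M : Type*} [Field k] [LieRing L] [LieAlgebra k L]
  [AddCommGroup M] [Module k M] [LieRingModule L M] [LieModule k L M]

/-- Cyclicity of the trace: `tr (zyc) = tr (ycz) = tr (yzc)` when `z` commutes with `c`. -/
theorem LieModule.trace_toEnd_mul_eq_zero_of_mem_lie (I J : LieIdeal k L) {x : L}
    (hx : x ∈ ⁅I, J⁆) (c : Module.End k M) (hc : ∀ y ∈ J, Commute (toEnd k L M y) c) :
    LinearMap.trace k M (toEnd k L M x * c) = 0 := by
  rw [← LieSubmodule.mem_toSubmodule, LieSubmodule.lieIdeal_oper_eq_linear_span'] at hx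
  induction hx using Submodule.span_induction with
  | mem x hx =>
    obtain ⟨y, -, z, hz, rfl⟩ := hx
    rw [LieHom.map_lie, Ring.lie_def, sub_mul, map_sub, mul_assoc, (hc z hz).eq, ← mul_assoc,
      mul_assoc _ _ c, LinearMap.trace_mul_comm k _ (toEnd k L M y * c), mul_assoc, sub_self]
  | zero => simp
  | add x y _ _ hx hy => rw [map_add, add_mul, map_add, hx, hy, add_zero]
  | smul a x _ hx => rw [map_smul, smul_mul_assoc, map_smul, hx, smul_zero]

variable [FiniteDimensional k M]

/-- Polynomials in `x` commute with `J`, so the trace lemma kills all `tr (x p(x))`. -/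
theorem LieModule.isNilpotent_toEnd_of_mem_lie [CharZero k] (I J : LieIdeal k L) {x : L}
    (hx : x ∈ ⁅I, J⁆) (hc : ∀ y ∈ J, ⁅y, x⁆ = 0) :
    _root_.IsNilpotent (toEnd k L M x) := by
  refine Module.End.isNilpotent_of_forall_trace_mul_aeval_eq_zero _ fun p =>
    LieModule.trace_toEnd_mul_eq_zero_of_mem_lie I J hx _ fun y hy => ?_
  have : Commute (toEnd k L M y) (toEnd k L M x) := by
    rw [commute_iff_lie_eq, ← LieHom.map_lie, hc y hy, map_zero]
  exact Algebra.commute_of_mem_adjoin_singleton_of_commute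
    (Polynomial.aeval_mem_adjoin_singleton k _) this

/-- An ideal which acts nilpotently on a faithful semisimple module vanishes. -/
theorem LieIdeal.eq_bot_of_forall_isNilpotent_toEnd
    (M : Type*) [AddCommGroup M] [Module k M] [LieRingModule L M] [LieModule k L M]
    [FiniteDimensional k M] [ComplementedLattice (LieSubmodule k L M)] [LieModule.IsFaithful k L M]
    (I : LieIdeal k L)
    (h : ∀ x ∈ I, IsNilpotent (toEnd k L M x)) : I = ⊥ := by
  -- The vectors killed by `I`, stable under `L` because `I` is an ideal. By Engel, a nonzero
  -- complement would contain another such vector.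
  let W : LieSubmodule k L M :=
    { (maxTrivSubmodule k I M).toSubmodule with
      lie_mem := by
        intro x m hm
        change ∀ y : I, ⁅y, m⁆ = 0 at hm
        change ∀ y : I, ⁅y, ⁅x, m⁆⁆ = 0
        intro y
        have h1 := hm ⟨⁅(y : L), x⁆, lie_mem_left k L I _ _ y.2⟩
        change ⁅⁅(y : L), x⁆, m⁆ = 0 at h1
        have h2 : ⁅(y : L), m⁆ = 0 := hm y
        change ⁅(y : L), ⁅x, m⁆⁆ = 0
        rw [leibniz_lie, h1, h2, lie_zero, add_zero] }
  have hW : ∀ m, m ∈ W ↔ ∀ y ∈ I, ⁅y, m⁆ = 0 := fun m =>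
    ⟨fun hm y hy => hm ⟨y, hy⟩, fun hm y => hm y y.2⟩
  obtain ⟨N, hN⟩ := exists_isCompl W
  have hN0 : N = ⊥ := by
    by_contra hne
    have : Nontrivial N := (LieSubmodule.nontrivial_iff_ne_bot k L M).2 hne
    have : LieModule.IsNilpotent I N := by
      rw [LieModule.isNilpotent_iff_forall' (R := k)]
      rintro ⟨x, hx⟩
      obtain ⟨r, hr⟩ := h x hx
      refine ⟨r, LinearMap.ext fun m => Subtype.ext ?_⟩
      have key : ∀ s, (((toEnd k I N ⟨x, hx⟩) ^ s) m : M) = ((toEnd k L M x) ^ s) (m : M) := by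
        intro s
        induction s with
        | zero => rfl
        | succ s ih =>
          rw [pow_succ', pow_succ', Module.End.mul_apply, Module.End.mul_apply, ← ih]
          rfl
      rw [key, hr]
      rfl
    have := nontrivial_max_triv_of_isNilpotent k I N
    obtain ⟨⟨m, hm⟩, hm0⟩ := exists_ne (0 : maxTrivSubmodule k I N)
    have hmW : (m : M) ∈ W := (hW _).2 fun y hy => congrArg Subtype.val (hm ⟨y, hy⟩)
    have : (m : M) ∈ W ⊓ N := ⟨hmW, m.2⟩
    rw [hN.inf_eq_bot, LieSubmodule.mem_bot] at this
    exact hm0 (Subtype.ext (Subtype.ext this))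
  have hWtop : W = ⊤ := by simpa [hN0] using hN.sup_eq_top
  rw [LieSubmodule.eq_bot_iff]
  intro x hx
  rw [← toEnd_eq_zero_iff (R := k) (L := L) (M := M)]
  ext m
  exact (hW m).1 (hWtop ▸ LieSubmodule.mem_top m) x hx

variable (k L) [CharZero k]

/-- `[L, A]` lies in the abelian ideal `A`, so it commutes with `A` and acts nilpotently; hence it
vanishes. -/
theorem LieIdeal.le_center_of_isLieAbelian
    (M : Type*) [AddCommGroup M] [Module k M] [LieRingModule L M] [LieModule k L M]
    [FiniteDimensional k M] [ComplementedLattice (LieSubmodule k L M)] [LieModule.IsFaithful k L M]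
    (A : LieIdeal k L) (hA : ∀ x ∈ A, ∀ y ∈ A, ⁅x, y⁆ = 0) :
    A ≤ center k L := by
  have h : ⁅(⊤ : LieIdeal k L), A⁆ = ⊥ := by
    refine LieIdeal.eq_bot_of_forall_isNilpotent_toEnd M _ fun x hx => ?_
    exact LieModule.isNilpotent_toEnd_of_mem_lie _ _ hx fun y hy =>
      hA y hy x (LieSubmodule.lie_le_right _ _ hx)
  intro x hx
  rw [LieModule.mem_maxTrivSubmodule]
  intro y
  have : ⁅y, x⁆ ∈ ⁅(⊤ : LieIdeal k L), A⁆ := LieSubmodule.lie_mem_lie (LieSubmodule.mem_top y) hx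
  rwa [h, LieSubmodule.mem_bot] at this

theorem LieAlgebra.center_inf_lie_top_eq_bot
    (M : Type*) [AddCommGroup M] [Module k M] [LieRingModule L M] [LieModule k L M]
    [FiniteDimensional k M] [ComplementedLattice (LieSubmodule k L M)]
    [LieModule.IsFaithful k L M] :
    center k L ⊓ ⁅(⊤ : LieIdeal k L), (⊤ : LieIdeal k L)⁆ = ⊥ :=
  LieIdeal.eq_bot_of_forall_isNilpotent_toEnd M _ fun _ hx =>
    LieModule.isNilpotent_toEnd_of_mem_lie _ _ hx.2 fun y _ =>
      (LieModule.mem_maxTrivSubmodule k L L _).1 hx.1 y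

/-- A Lie algebra with a faithful semisimple representation is reductive. -/
theorem LieAlgebra.hasCentralRadical_of_complementedLattice [FiniteDimensional k L]
    (M : Type*) [AddCommGroup M] [Module k M] [LieRingModule L M] [LieModule k L M]
    [FiniteDimensional k M] [ComplementedLattice (LieSubmodule k L M)]
    [LieModule.IsFaithful k L M] :
    HasCentralRadical k L := by
  refine hasCentralRadical_of_radical_le k L ?_
  -- The last nonzero term `A` of the derived series of this ideal is abelian, hence central; it
  -- also lies in `[L, L]`, so it is zero.
  have hJ : ⁅radical k L, radical k L⁆ = ⊥ := by
    have hle : ⁅radical k L, radical k L⁆ ≤ radical k L := LieSubmodule.lie_le_right _ _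
    have := (LieIdeal.solvable_iff_le_radical k L _).2 hle
    rw [← abelian_of_solvable_ideal_eq_bot_iff, eq_bot_iff,
      ← LieAlgebra.center_inf_lie_top_eq_bot k L M, le_inf_iff]
    set A := derivedAbelianOfIdeal ⁅radical k L, radical k L⁆ with hA
    have hAb : IsLieAbelian A := abelian_derivedAbelianOfIdeal _
    constructor
    · exact LieIdeal.le_center_of_isLieAbelian k L M A fun x hx y hy =>
        congrArg Subtype.val (hAb.trivial ⟨x, hx⟩ ⟨y, hy⟩)
    · have hAJ : A ≤ ⁅radical k L, radical k L⁆ := by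
        rw [hA, derivedAbelianOfIdeal]
        split
        · exact bot_le
        · exact derivedSeriesOfIdeal_le_self _ _
      exact hAJ.trans (LieSubmodule.mono_lie le_top le_top)
  refine LieIdeal.le_center_of_isLieAbelian k L M _ fun x hx y hy => ?_
  have := LieSubmodule.lie_mem_lie hx hy
  rwa [hJ, LieSubmodule.mem_bot] at this

/-- A dimension count: the Killing orthogonal of `[L, L]` is central, so `dim Z` is at least the
codimension of `[L, L]`, while `Z` meets `[L, L]` trivially. -/
theorem LieAlgebra.center_sup_lie_top_eq_top [FiniteDimensional k L]
    (M : Type*) [AddCommGroup M] [Module k M] [LieRingModule L M] [LieModule k L M]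
    [FiniteDimensional k M] [ComplementedLattice (LieSubmodule k L M)]
    [LieModule.IsFaithful k L M] :
    (center k L).toSubmodule ⊔ (⁅(⊤ : LieIdeal k L), (⊤ : LieIdeal k L)⁆).toSubmodule = ⊤ := by
  have := LieAlgebra.hasCentralRadical_of_complementedLattice k L M
  set D := ⁅(⊤ : LieIdeal k L), (⊤ : LieIdeal k L)⁆ with hD
  have hinf : center k L ⊓ D = ⊥ := LieAlgebra.center_inf_lie_top_eq_bot k L M
  have horth : (killingForm k L).orthogonal D.toSubmodule ≤ (center k L).toSubmodule := by
    intro x hx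
    rw [LieSubmodule.mem_toSubmodule, LieModule.mem_maxTrivSubmodule]
    intro y
    -- By invariance `[y, x]` is Killing-orthogonal to all of `L`, hence in the radical, which is
    -- the center.
    have h1 : ⁅y, x⁆ ∈ center k L := by
      rw [← radical_eq_center]
      refine killingCompl_top_le_radical k L ((LieIdeal.mem_killingCompl k L ⊤).2 fun z _ => ?_)
      rw [← LieModule.traceForm_apply_lie_apply]
      exact hx _ (LieSubmodule.lie_mem_lie (LieSubmodule.mem_top z) (LieSubmodule.mem_top y))
    have h2 : ⁅y, x⁆ ∈ center k L ⊓ D :=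
      ⟨h1, LieSubmodule.lie_mem_lie (LieSubmodule.mem_top y) (LieSubmodule.mem_top x)⟩
    rwa [hinf, LieSubmodule.mem_bot] at h2
  have hdim := LinearMap.BilinForm.finrank_add_finrank_orthogonal'
    (B := killingForm k L) D.toSubmodule
  have hZ := Submodule.finrank_mono horth
  have hsum := Submodule.finrank_sup_add_finrank_inf_eq (center k L).toSubmodule D.toSubmodule
  rw [← LieSubmodule.inf_toSubmodule, hinf, LieSubmodule.bot_toSubmodule, finrank_bot] at hsum
  refine Submodule.eq_top_of_finrank_eq (le_antisymm (Submodule.finrank_le _) ?_)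
  omega

end SemisimpleModules

/-! ### Generators of `𝒯ₙ` and the central element `sumT` -/

namespace InfBraid

open LieAlgebra Module

section Generators

variable {k : Type*} [CommRing k] {n : ℕ}

/-- The generators `t_{ij}` generate the Lie algebra of infinitesimal pure braids. -/
theorem PureLie.eq_top_of_t_mem (K : LieSubalgebra k (PureLie k n)) (h : ∀ i j, t k i j ∈ K) :
    K = ⊤ := by
  -- The presentation yields a map `𝒯ₙ → K` whose composite with the inclusion fixes the generators,
  -- hence is the identity.
  let g : Fin n × Fin n → K := fun p => ⟨t k p.1 p.2, h p.1 p.2⟩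
  have hg : K.incl.comp (FreeLieAlgebra.lift k g) = PureLie.mk :=
    FreeLieAlgebra.hom_ext fun p => by
      rw [LieHom.comp_apply, FreeLieAlgebra.lift_of_apply]
      rfl
  have hrel : ∀ x, PureRel k n x → FreeLieAlgebra.lift k g x = 0 := fun x hx =>
    Subtype.ext ((LieHom.congr_fun hg x).trans (PureLie.mk_eq_zero hx))
  have hid : K.incl.comp (PureLie.lift g hrel) = LieHom.id :=
    PureLie.hom_ext fun i j => by
      rw [LieHom.comp_apply, PureLie.lift_t]
      rfl
  rw [eq_top_iff]
  intro x _
  have hx : ((PureLie.lift g hrel x : K) : PureLie k n) = x := LieHom.congr_fun hid x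
  exact hx ▸ (PureLie.lift g hrel x).2

theorem lie_t_add_t (i j l : Fin n) : ⁅t k i j, t k i l⁆ + ⁅t k i j, t k l j⁆ = 0 := by
  rw [← lie_add, t_triple]

/-- Summing over ordered pairs, a row `p ∉ {i, j}` contributes only at `q = i, j`, and these two
terms cancel; rows `i` and `j` cancel each other column by column. -/
theorem lie_t_sum_t (i j : Fin n) : ⁅t k i j, ∑ p : Fin n, ∑ q : Fin n, t k p q⁆ = 0 := by
  rcases eq_or_ne i j with rfl | hij
  · rw [t_diag, zero_lie]
  have hF : ∀ p, ⁅t k i j, t k p i⁆ + ⁅t k i j, t k p j⁆ = 0 := fun p => by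
    rw [t_symm p i, lie_t_add_t]
  have hrow : ∀ p, p ≠ i → p ≠ j → ∑ q, ⁅t k i j, t k p q⁆ = 0 := by
    intro p hpi hpj
    rw [← hF p, ← Finset.sum_pair (f := fun q => ⁅t k i j, t k p q⁆) hij]
    refine (Finset.sum_subset (Finset.subset_univ _) fun q _ hq => ?_).symm
    simp only [Finset.mem_insert, Finset.mem_singleton, not_or] at hq
    rcases eq_or_ne p q with rfl | hpq
    · rw [t_diag, lie_zero]
    · refine t_comm ?_
      simp only [List.nodup_cons, List.mem_cons, List.not_mem_nil, or_false, not_or,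
        not_false_eq_true, List.nodup_nil, and_true]
      exact ⟨⟨hij, hpi.symm, Ne.symm hq.1⟩, ⟨hpj.symm, Ne.symm hq.2⟩, hpq⟩
  simp only [lie_sum]
  rw [← Finset.sum_subset (Finset.subset_univ {i, j}) fun p _ hp => ?_, Finset.sum_pair hij,
    ← Finset.sum_add_distrib]
  · exact Finset.sum_eq_zero fun q _ => by rw [t_symm j q, lie_t_add_t]
  · simp only [Finset.mem_insert, Finset.mem_singleton, not_or] at hp
    exact hrow p hp.1 hp.2

theorem two_smul_sumT : (2 : ℕ) • sumT k n = ∑ p : Fin n, ∑ q : Fin n, t k p q := by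
  have hswap : ∑ p : Fin n × Fin n with p.2 < p.1, t k p.1 p.2 = sumT k n :=
    Finset.sum_nbij' Prod.swap Prod.swap (by simp) (by simp) (by simp) (by simp)
      fun p _ => t_symm _ _
  rw [← Fintype.sum_prod_type' (f := fun p q => t k p q),
    ← Finset.sum_filter_add_sum_filter_not Finset.univ (fun p : Fin n × Fin n => p.1 < p.2),
    two_nsmul]
  congr 1
  rw [← hswap]
  refine Finset.sum_subset (fun p hp => ?_) fun p hp hp' => ?_
  · simp only [Finset.mem_filter, Finset.mem_univ, true_and, not_lt] at hp ⊢
    exact hp.le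
  · simp only [Finset.mem_filter, Finset.mem_univ, true_and, not_lt] at hp hp'
    rw [le_antisymm hp hp', t_diag]

end Generators

variable {k : Type*} [Field k] {n : ℕ}

theorem sumT_mem_center [CharZero k] : sumT k n ∈ center k (PureLie k n) := by
  let K : LieSubalgebra k (PureLie k n) :=
    { LinearMap.ker (LieAlgebra.ad k (PureLie k n) (sumT k n)) with
      lie_mem' := by
        intro x y hx hy
        change ⁅sumT k n, ⁅x, y⁆⁆ = 0
        change ⁅sumT k n, x⁆ = 0 at hx
        change ⁅sumT k n, y⁆ = 0 at hy
        rw [leibniz_lie, hx, hy, zero_lie, lie_zero, add_zero] }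
  have hK : K = ⊤ := by
    refine PureLie.eq_top_of_t_mem K fun i j => ?_
    change ⁅sumT k n, t k i j⁆ = 0
    have h : (2 : ℕ) • ⁅t k i j, sumT k n⁆ = 0 := by
      rw [← lie_nsmul, two_smul_sumT, lie_t_sum_t]
    rw [← lie_skew, neg_eq_zero]
    rw [← Nat.cast_smul_eq_nsmul k, smul_eq_zero] at h
    exact h.resolve_left (by norm_num)
  rw [LieModule.mem_maxTrivSubmodule]
  intro x
  have : ⁅sumT k n, x⁆ = 0 := show x ∈ K by rw [hK]; exact LieSubalgebra.mem_top x
  rw [← lie_skew, this, neg_zero]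

/-! ### Restriction from `𝔅ₙ` to `𝒯ₙ` -/

section Representation

variable {V : Type*} [AddCommGroup V] [Module k V] (ρ : BraidAlg k n →ₐ[k] Module.End k V)

theorem map_perm_mul_restrictPure (σ : Equiv.Perm (Fin n)) (x : PureLie k n) :
    ρ (perm k σ) * restrictPure ρ x = restrictPure ρ (permHom σ x) * ρ (perm k σ) := by
  change ρ (perm k σ) * ρ (ofPure x) = ρ (ofPure (permHom σ x)) * ρ (perm k σ)
  rw [← map_mul, ← map_mul]
  congr 1
  change SkewMonoidAlgebra.of _ _ σ * SkewMonoidAlgebra.single 1 _ =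
    SkewMonoidAlgebra.single 1 _ * SkewMonoidAlgebra.of _ _ σ
  rw [SkewMonoidAlgebra.of_apply, SkewMonoidAlgebra.single_mul_single,
    SkewMonoidAlgebra.single_mul_single, one_mul, mul_one, one_mul, one_smul, mul_one,
    perm_smul_def, permAlgHom_ι]

theorem map_perm_mul (σ τ : Equiv.Perm (Fin n)) :
    ρ (perm k (σ * τ)) = ρ (perm k σ) * ρ (perm k τ) := by
  rw [perm, map_mul, map_mul]
  rfl

theorem map_perm_one : ρ (perm k (1 : Equiv.Perm (Fin n))) = 1 := by
  rw [perm, map_one, map_one]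

theorem map_perm_mul_map_perm_inv (σ : Equiv.Perm (Fin n)) :
    ρ (perm k σ) * ρ (perm k σ⁻¹) = 1 := by
  rw [← map_perm_mul, mul_inv_cancel, map_perm_one]

theorem restrictPure_permHom (σ : Equiv.Perm (Fin n)) (x : PureLie k n) :
    restrictPure ρ (permHom σ x) = ρ (perm k σ) * restrictPure ρ x * ρ (perm k σ⁻¹) := by
  rw [map_perm_mul_restrictPure, mul_assoc, map_perm_mul_map_perm_inv, mul_one]

/-- The associative algebra generated by the image of the pure infinitesimal braids. -/
abbrev pureImage : Subalgebra k (Module.End k V) :=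
  Algebra.adjoin k (Set.range (restrictPure ρ))

theorem aeval_conj {A : Type*} [Ring A] [Algebra k A] (u v a : A) (h : v * u = 1) (h' : u * v = 1)
    (P : Polynomial k) : Polynomial.aeval (u * a * v) P = u * Polynomial.aeval a P * v := by
  induction P using Polynomial.induction_on' with
  | add p q hp hq => rw [map_add, map_add, hp, hq, mul_add, add_mul]
  | monomial m c =>
    rw [Polynomial.aeval_monomial, Polynomial.aeval_monomial, ← mul_assoc, ← Algebra.commutes,
      mul_assoc, mul_assoc, mul_assoc]
    congr 1
    induction m with
    | zero => rw [pow_zero, pow_zero, one_mul, h']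
    | succ m ih =>
      rw [pow_succ, pow_succ, ih, mul_assoc, mul_assoc, ← mul_assoc v u, h, one_mul,
        mul_assoc]

theorem exists_perm_apply_eq (hn : 2 ≤ n) {i j : Fin n} (hij : i ≠ j) :
    ∃ σ : Equiv.Perm (Fin n), σ ⟨0, by omega⟩ = i ∧ σ ⟨1, by omega⟩ = j := by
  have h01 : (⟨0, by omega⟩ : Fin n) ≠ ⟨1, by omega⟩ := by simp
  -- The right factor sends `0` to `i`; the left one then moves the image of `1` to `j` and fixes
  -- `i`.
  refine ⟨Equiv.swap (Equiv.swap ⟨0, by omega⟩ i ⟨1, by omega⟩) j * Equiv.swap ⟨0, by omega⟩ i,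
    ?_, by simp⟩
  rw [Equiv.Perm.mul_apply, Equiv.swap_apply_left, Equiv.swap_apply_of_ne_of_ne _ hij]
  intro h
  have h2 : Equiv.swap (⟨0, by omega⟩ : Fin n) i ⟨0, by omega⟩ =
    Equiv.swap ⟨0, by omega⟩ i ⟨1, by omega⟩ := by rw [Equiv.swap_apply_left, ← h]
  exact h01 (Equiv.injective _ h2)

variable {ρ}

/-- Transpositions generate, and conjugating the purity relation makes `(i j)` the same polynomial
in `tᵢⱼ`. -/
theorem map_perm_mem_pureImage {hn : 2 ≤ n} (hpure : IsEssentiallyPure hn ρ)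
    (σ : Equiv.Perm (Fin n)) : ρ (perm k σ) ∈ pureImage ρ := by
  induction σ using Equiv.Perm.swap_induction_on with
  | one => rw [map_perm_one]; exact one_mem _
  | swap_mul σ i j hij h =>
    rw [map_perm_mul]
    refine mul_mem ?_ h
    obtain ⟨P, hP⟩ := hpure
    obtain ⟨τ, rfl, rfl⟩ := exists_perm_apply_eq hn hij
    rw [Equiv.swap_apply_apply, map_perm_mul, map_perm_mul, hP, ← aeval_conj,
      ← restrictPure_permHom]
    · exact Polynomial.aeval_mem_adjoin_singleton k _ |> Algebra.adjoin_mono (by simp)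
    · rw [← map_perm_mul, inv_mul_cancel, map_perm_one]
    · exact map_perm_mul_map_perm_inv ρ τ

theorem map_mem_pureImage {hn : 2 ≤ n} (hpure : IsEssentiallyPure hn ρ) (b : BraidAlg k n) :
    ρ b ∈ pureImage ρ := by
  have hU : ∀ u : PureEnv k n, ρ (SkewMonoidAlgebra.single 1 u) ∈ pureImage ρ := by
    let F : PureEnv k n →ₐ[k] Module.End k V := ρ.comp
      { toFun := fun u => SkewMonoidAlgebra.single 1 u
        map_one' := rfl
        map_mul' := fun u v => by
          rw [SkewMonoidAlgebra.single_mul_single, one_mul, one_smul]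
        map_zero' := SkewMonoidAlgebra.single_zero _
        map_add' := fun u v => SkewMonoidAlgebra.single_add _ _ _
        commutes' := fun c => rfl }
    let G : PureLie k n →ₗ⁅k⁆ pureImage ρ :=
      { toFun := fun x => ⟨restrictPure ρ x, Algebra.subset_adjoin ⟨x, rfl⟩⟩
        map_add' := fun x y => Subtype.ext (map_add _ x y)
        map_smul' := fun c x => Subtype.ext (map_smul _ c x)
        map_lie' := fun {x y} => Subtype.ext (LieHom.map_lie _ x y) }
    have hFG : F = (pureImage ρ).val.comp (UniversalEnvelopingAlgebra.lift k G) := by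
      apply UniversalEnvelopingAlgebra.hom_ext
      ext x : 1
      change F _ = ((UniversalEnvelopingAlgebra.lift k G
        (UniversalEnvelopingAlgebra.ι k x) : pureImage ρ) : Module.End k V)
      rw [UniversalEnvelopingAlgebra.lift_ι_apply]
      rfl
    intro u
    change F u ∈ pureImage ρ
    rw [hFG]
    exact (UniversalEnvelopingAlgebra.lift k G u).2
  induction b using SkewMonoidAlgebra.induction_on with
  | zero => rw [map_zero]; exact zero_mem _
  | single g u =>
    have : SkewMonoidAlgebra.single g u = SkewMonoidAlgebra.single 1 u * perm k g := by
      rw [perm, SkewMonoidAlgebra.of_apply, SkewMonoidAlgebra.single_mul_single, one_mul, one_smul,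
        mul_one]
    rw [this, map_mul]
    exact mul_mem (hU u) (map_perm_mem_pureImage hpure g)
  | add f g hf hg => rw [map_add]; exact add_mem hf hg

/-- The restriction to the pure infinitesimal braids of an essentially pure semisimple
representation is semisimple. -/
theorem complementedLattice_of_isSemisimpleRep {hn : 2 ≤ n} (hpure : IsEssentiallyPure hn ρ)
    (hss : IsSemisimpleRep ρ) : ComplementedLattice (LieSubmodule k (imageLie ρ) V) := by
  let _ : Module (BraidAlg k n) V := Module.compHom V (ρ : BraidAlg k n →+* Module.End k V)
  have hsmul : ∀ (b : BraidAlg k n) (v : V), b • v = ρ b v := fun _ _ => rfl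
  have hss' : IsSemisimpleModule (BraidAlg k n) V := hss
  -- A Lie submodule is stable under the generated associative algebra, hence under `ρ(𝔅ₙ)`; its
  -- complement can be taken over `𝔅ₙ`.
  have hinv : ∀ (N : LieSubmodule k (imageLie ρ) V) (f : Module.End k V), f ∈ pureImage ρ →
      ∀ v ∈ N, f v ∈ N := by
    intro N f hf
    induction hf using Algebra.adjoin_induction with
    | mem f hf => exact fun v hv => N.lie_mem (x := (⟨f, hf⟩ : imageLie ρ)) hv
    | algebraMap c => exact fun v hv => N.smul_mem c hv
    | add f g _ _ hf hg => exact fun v hv => N.add_mem (hf v hv) (hg v hv)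
    | mul f g _ _ hf hg => exact fun v hv => hf _ (hg v hv)
  refine ⟨fun N => ?_⟩
  let W : Submodule (BraidAlg k n) V :=
    { N.toSubmodule.toAddSubmonoid with
      smul_mem' := fun b v hv => hinv N (ρ b) (map_mem_pureImage hpure b) v hv }
  obtain ⟨W', hW'⟩ := exists_isCompl W
  let N' : LieSubmodule k (imageLie ρ) V :=
    { W'.toAddSubmonoid with
      smul_mem' := fun c v hv => by
        have := W'.smul_mem (algebraMap k (BraidAlg k n) c) hv
        rw [hsmul, AlgHom.commutes] at this
        exact this
      lie_mem := by
        rintro ⟨-, x, rfl⟩ v hv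
        exact W'.smul_mem (ofPure x) hv }
  refine ⟨N', ?_, ?_⟩
  · rw [disjoint_iff, LieSubmodule.eq_bot_iff]
    intro v hv
    have : v ∈ W ⊓ W' := hv
    rwa [hW'.inf_eq_bot] at this
  · rw [codisjoint_iff, eq_top_iff]
    intro v _
    have : v ∈ W ⊔ W' := hW'.sup_eq_top ▸ Submodule.mem_top
    obtain ⟨w, hw, w', hw', rfl⟩ := Submodule.mem_sup.1 this
    exact (LieSubmodule.mem_sup _ _ _).2 ⟨w, hw, w', hw', rfl⟩

end Representation

end InfBraid

namespace InfBraid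

open LieAlgebra Module

/-! ### Splitness from a regular element -/

section Split

variable {k : Type*} [Field k] {V : Type*} [AddCommGroup V] [Module k V]
  {ι : Type*} (b : Basis ι k V)

theorem repr_apply_of_diagonal {d : ι → k} {f : Module.End k V} (hf : ∀ i, f (b i) = d i • b i)
    (v : V) (i : ι) : b.repr (f v) i = d i * b.repr v i := by
  classical
  have h : (b.coord i).comp f = d i • b.coord i := by
    refine b.ext fun j => ?_
    rcases eq_or_ne j i with rfl | hji
    · simp [hf]
    · simp [hf, Finsupp.single_eq_of_ne' hji]
  exact LinearMap.congr_fun h v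

theorem iSup_eigenspace_ad_of_diagonal [Fintype ι] [DecidableEq ι] {d : ι → k} {f : Module.End k V}
    (hf : ∀ i, f (b i) = d i • b i) :
    ⨆ μ : k, (LieAlgebra.ad k (Module.End k V) f).eigenspace μ = ⊤ := by
  rw [eq_top_iff, ← b.end.span_eq, Submodule.span_le]
  rintro - ⟨⟨i, j⟩, rfl⟩
  -- Matrix units are eigenvectors of `ad f`.
  refine Submodule.mem_iSup_of_mem (d i - d j) ?_
  rw [Module.End.mem_eigenspace_iff]
  exact b.lie_end_of_apply_eq_smul d f hf i j

/-- A linear Lie algebra containing a diagonalizable endomorphism with distinct eigenvalues is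
split. -/
theorem isSplitLie_of_isRegularEnd [FiniteDimensional k V]
    (H : LieSubalgebra k (Module.End k V)) (x : H) (hx : IsRegularEnd (x : Module.End k V)) :
    IsSplitLie k H := by
  classical
  obtain ⟨b, d, hd, hb⟩ := hx
  have hpow : ∀ (y : H) (m : ℕ) (i j), b.repr ((((LieAlgebra.ad k H x) ^ m) y : Module.End k V)
      (b j)) i = (d i - d j) ^ m * b.repr ((y : Module.End k V) (b j)) i := by
    intro y m i j
    induction m with
    | zero => simp
    | succ m ih =>
      rw [pow_succ', pow_succ', Module.End.mul_apply, LieAlgebra.ad_apply, LieSubalgebra.coe_bracket,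
        Ring.lie_def, LinearMap.sub_apply, Module.End.mul_apply, Module.End.mul_apply, hb, map_smul,
        map_sub, map_smul, Finsupp.sub_apply, Finsupp.smul_apply, repr_apply_of_diagonal b hb, ih,
        smul_eq_mul]
      ring
  -- Since `(ad x) ^ m` scales the `(i, j)` entry by `(d i - d j) ^ m`, distinct eigenvalues force
  -- off-diagonal entries to vanish.
  have hdiag : ∀ y ∈ LieSubalgebra.engel k x, ∀ j,
      (y : Module.End k V) (b j) = b.repr ((y : Module.End k V) (b j)) j • b j := by
    intro y hy j
    obtain ⟨m, hm⟩ := (LieSubalgebra.mem_engel_iff k x y).1 hy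
    refine b.ext_elem fun i => ?_
    rcases eq_or_ne j i with rfl | hji
    · simp
    · have h := hpow y m i j
      rw [hm, ZeroMemClass.coe_zero, LinearMap.zero_apply, map_zero, Finsupp.zero_apply, eq_comm,
        mul_eq_zero] at h
      rw [h.resolve_left (pow_ne_zero _ (sub_ne_zero.2 (hd.ne hji.symm)))]
      simp [Finsupp.single_eq_of_ne' hji]
  have hab : IsLieAbelian (LieSubalgebra.engel k x) := by
    refine ⟨fun y z => Subtype.ext (Subtype.ext ?_)⟩
    change ⁅((y : H) : Module.End k V), ((z : H) : Module.End k V)⁆ = 0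
    rw [Ring.lie_def, sub_eq_zero]
    refine b.ext fun j => ?_
    rw [Module.End.mul_apply, Module.End.mul_apply, hdiag z z.2 j, hdiag y y.2 j, map_smul,
      map_smul, hdiag y y.2 j, hdiag z z.2 j, smul_smul, smul_smul]
    simp [mul_comm]
  -- An Engel subalgebra is self-normalizing; being abelian, this one is Cartan. Diagonalizability
  -- of `ad y` restricts from `𝔤𝔩(V)` to the stable subspace `H`.
  refine ⟨LieSubalgebra.engel k x, ⟨inferInstance, LieSubalgebra.normalizer_engel k x⟩,
    fun y hy => ?_⟩
  have hinv : ∀ z ∈ H.toSubmodule,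
      LieAlgebra.ad k (Module.End k V) (y : Module.End k V) z ∈ H.toSubmodule :=
    fun z hz => H.lie_mem y.2 hz
  exact Module.End.genEigenspace_restrict_eq_top (k := 1) hinv
    (iSup_eigenspace_ad_of_diagonal b (hdiag y hy))

end Split

/-! ### The center of the image -/

section Center

variable {k : Type*} [Field k] {n : ℕ}

theorem permHom_mem_lie_top (σ : Equiv.Perm (Fin n)) {x : PureLie k n}
    (hx : x ∈ ⁅(⊤ : LieIdeal k (PureLie k n)), (⊤ : LieIdeal k (PureLie k n))⁆) :
    permHom σ x ∈ ⁅(⊤ : LieIdeal k (PureLie k n)), (⊤ : LieIdeal k (PureLie k n))⁆ := by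
  rw [← LieSubmodule.mem_toSubmodule, LieSubmodule.lieIdeal_oper_eq_linear_span'] at hx
  induction hx using Submodule.span_induction with
  | mem x hx =>
    obtain ⟨y, -, z, -, rfl⟩ := hx
    rw [LieHom.map_lie]
    exact LieSubmodule.lie_mem_lie (LieSubmodule.mem_top _) (LieSubmodule.mem_top _)
  | zero => rw [map_zero]; exact zero_mem _
  | add x y _ _ hx hy => rw [map_add]; exact add_mem hx hy
  | smul a x _ hx => rw [map_smul]; exact Submodule.smul_mem _ a hx

variable {V : Type*} [AddCommGroup V] [Module k V] (ρ : BraidAlg k n →ₐ[k] Module.End k V)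

/-- The surjection of the pure infinitesimal braids onto their image. -/
noncomputable abbrev toImageLie : PureLie k n →ₗ⁅k⁆ imageLie ρ := (restrictPure ρ).rangeRestrict

theorem toImageLie_surjective : Function.Surjective (toImageLie ρ) :=
  (restrictPure ρ).surjective_rangeRestrict

theorem mem_lie_top_imageLie_iff {w : imageLie ρ} :
    w ∈ ⁅(⊤ : LieIdeal k (imageLie ρ)), (⊤ : LieIdeal k (imageLie ρ))⁆ ↔
      ∃ d ∈ ⁅(⊤ : LieIdeal k (PureLie k n)), (⊤ : LieIdeal k (PureLie k n))⁆,
        toImageLie ρ d = w := by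
  constructor
  · intro hw
    rw [← LieSubmodule.mem_toSubmodule, LieSubmodule.lieIdeal_oper_eq_linear_span'] at hw
    suffices h : Submodule.span k _ ≤ Submodule.map (toImageLie ρ : PureLie k n →ₗ[k] imageLie ρ)
        (⁅(⊤ : LieIdeal k (PureLie k n)), (⊤ : LieIdeal k (PureLie k n))⁆).toSubmodule from h hw
    rw [Submodule.span_le]
    rintro - ⟨y, -, z, -, rfl⟩
    obtain ⟨y, rfl⟩ := toImageLie_surjective ρ y
    obtain ⟨z, rfl⟩ := toImageLie_surjective ρ z
    exact ⟨⁅y, z⁆, LieSubmodule.lie_mem_lie (LieSubmodule.mem_top _) (LieSubmodule.mem_top _),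
      LieHom.map_lie _ y z⟩
  · rintro ⟨d, hd, rfl⟩
    rw [← LieSubmodule.mem_toSubmodule, LieSubmodule.lieIdeal_oper_eq_linear_span'] at hd
    induction hd using Submodule.span_induction with
    | mem x hx =>
      obtain ⟨y, -, z, -, rfl⟩ := hx
      rw [LieHom.map_lie]
      exact LieSubmodule.lie_mem_lie (LieSubmodule.mem_top _) (LieSubmodule.mem_top _)
    | zero => rw [map_zero]; exact zero_mem _
    | add x y _ _ hx hy => rw [map_add]; exact add_mem hx hy
    | smul a x _ hx => rw [map_smul]; exact Submodule.smul_mem _ a hx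

variable {ρ}

theorem toImageLie_mem_center {x : PureLie k n} (hx : x ∈ center k (PureLie k n)) :
    toImageLie ρ x ∈ center k (imageLie ρ) := by
  rw [LieModule.mem_maxTrivSubmodule] at hx ⊢
  intro y
  obtain ⟨y, rfl⟩ := toImageLie_surjective ρ y
  rw [← LieHom.map_lie, hx, map_zero]

/-- Under essential purity this applies to the permutations, which is how they come to commute with
the center of `ℋ`. -/
theorem commute_of_mem_center {z : imageLie ρ} (hz : z ∈ center k (imageLie ρ))
    {f : Module.End k V} (hf : f ∈ pureImage ρ) : Commute f (z : Module.End k V) := by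
  induction hf using Algebra.adjoin_induction with
  | mem f hf =>
    rw [LieModule.mem_maxTrivSubmodule] at hz
    exact commute_iff_lie_eq.2 (congrArg Subtype.val (hz ⟨f, hf⟩))
  | algebraMap c => exact Algebra.commute_algebraMap_left c _
  | add f g _ _ hf hg => exact hf.add_left hg
  | mul f g _ _ hf hg => exact hf.mul_left hg

theorem card_filter_lt_ne_zero (hn : 2 ≤ n) :
    (Finset.univ.filter fun p : Fin n × Fin n => p.1 < p.2).card ≠ 0 :=
  Finset.card_ne_zero_of_mem (a := (⟨0, by omega⟩, ⟨1, by omega⟩)) (by simp)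

theorem trace_restrictPure_sumT (hn : 2 ≤ n) :
    LinearMap.trace k V (restrictPure ρ (sumT k n)) =
      (Finset.univ.filter fun p : Fin n × Fin n => p.1 < p.2).card •
        LinearMap.trace k V (restrictPure ρ (t k ⟨0, by omega⟩ ⟨1, by omega⟩)) := by
  rw [sumT, map_sum, map_sum]
  refine Finset.sum_eq_card_nsmul fun p hp => ?_
  obtain ⟨σ, h1, h2⟩ := exists_perm_apply_eq hn (Finset.mem_filter.1 hp).2.ne
  rw [← h1, ← h2, ← permHom_t, restrictPure_permHom, mul_assoc, LinearMap.trace_mul_comm,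
    mul_assoc, ← map_perm_mul, inv_mul_cancel, map_perm_one, mul_one]

variable [FiniteDimensional k V] [CharZero k]

theorem center_imageLie_le_span {hn : 2 ≤ n} (hpure : IsEssentiallyPure hn ρ)
    (hss : IsSemisimpleRep ρ) {y : imageLie ρ} (hy : y ∈ center k (imageLie ρ)) :
    ∃ c : k, y = c • toImageLie ρ (sumT k n) := by
  have := complementedLattice_of_isSemisimpleRep hpure hss
  set D := ⁅(⊤ : LieIdeal k (imageLie ρ)), (⊤ : LieIdeal k (imageLie ρ))⁆ with hD
  have hinf := center_inf_lie_top_eq_bot k (imageLie ρ) V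
  have hsup := center_sup_lie_top_eq_top k (imageLie ρ) V
  obtain ⟨z, hz, w, hw, hzw⟩ := Submodule.mem_sup.1
    (hsup ▸ Submodule.mem_top (x := toImageLie ρ (t k ⟨0, by omega⟩ ⟨1, by omega⟩)))
  obtain ⟨d, hd, rfl⟩ := (mem_lie_top_imageLie_iff ρ).1 hw
  -- Conjugation by `ρ(σ)` fixes `z` and preserves the image of the derived algebra, so one `z`
  -- serves all generators.
  have ht : ∀ i j : Fin n, i ≠ j → toImageLie ρ (t k i j) - z ∈ D := by
    intro i j hij
    obtain ⟨σ, rfl, rfl⟩ := exists_perm_apply_eq hn hij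
    refine (mem_lie_top_imageLie_iff ρ).2 ⟨_, permHom_mem_lie_top σ hd, Subtype.ext ?_⟩
    have hc := commute_of_mem_center hz (map_perm_mem_pureImage hpure σ)
    have hzw' : (z : Module.End k V) + restrictPure ρ d =
      restrictPure ρ (t k ⟨0, by omega⟩ ⟨1, by omega⟩) := congrArg Subtype.val hzw
    change restrictPure ρ _ = restrictPure ρ _ - (z : Module.End k V)
    rw [← permHom_t, restrictPure_permHom, restrictPure_permHom, ← hzw', mul_add, add_mul, hc.eq,
      mul_assoc (z : Module.End k V), map_perm_mul_map_perm_inv, mul_one, add_sub_cancel_left]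
  have hcen : ∀ y ∈ center k (imageLie ρ), ∀ c : k, y - c • z ∈ D → y = c • z := by
    intro y hy c h
    have : y - c • z ∈ center k (imageLie ρ) ⊓ D :=
      ⟨sub_mem hy (Submodule.smul_mem _ c hz), h⟩
    rwa [hinf, LieSubmodule.mem_bot, sub_eq_zero] at this
  have hspan : ∀ x : PureLie k n, ∃ c : k, toImageLie ρ x - c • z ∈ D := by
    let K : LieSubalgebra k (PureLie k n) :=
      { carrier := {x | ∃ c : k, toImageLie ρ x - c • z ∈ D}
        zero_mem' := ⟨0, by rw [map_zero, zero_smul, sub_zero]; exact zero_mem _⟩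
        add_mem' := by
          rintro x y ⟨c, hc⟩ ⟨e, he⟩
          refine ⟨c + e, ?_⟩
          rw [map_add, add_smul, add_sub_add_comm]
          exact add_mem hc he
        smul_mem' := by
          rintro a x ⟨c, hc⟩
          refine ⟨a * c, ?_⟩
          rw [map_smul, mul_smul, ← smul_sub]
          exact Submodule.smul_mem _ a hc
        lie_mem' := by
          intro x y _ _
          refine ⟨0, ?_⟩
          rw [zero_smul, sub_zero, LieHom.map_lie]
          exact LieSubmodule.lie_mem_lie (LieSubmodule.mem_top _) (LieSubmodule.mem_top _) }
    have hK : K = ⊤ := by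
      refine PureLie.eq_top_of_t_mem K fun i j => ?_
      rcases eq_or_ne i j with rfl | hij
      · rw [t_diag]
        exact zero_mem _
      · exact ⟨1, by rw [one_smul]; exact ht i j hij⟩
    intro x
    exact show x ∈ K by rw [hK]; exact LieSubalgebra.mem_top x
  set N := (Finset.univ.filter fun p : Fin n × Fin n => p.1 < p.2).card with hN
  -- Both sides are central and congruent modulo `D`, which meets the center trivially.
  have hT : toImageLie ρ (sumT k n) = (N : k) • z := by
    refine hcen _ (toImageLie_mem_center sumT_mem_center) _ ?_
    rw [sumT, map_sum, Nat.cast_smul_eq_nsmul, hN, ← Finset.sum_const, ← Finset.sum_sub_distrib]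
    exact sum_mem fun p hp => ht _ _ (Finset.mem_filter.1 hp).2.ne
  have hN0 : (N : k) ≠ 0 := Nat.cast_ne_zero.2 (card_filter_lt_ne_zero hn)
  obtain ⟨x, rfl⟩ := toImageLie_surjective ρ y
  obtain ⟨c, hc⟩ := hspan x
  refine ⟨c * (N : k)⁻¹, ?_⟩
  rw [hcen _ hy c hc, hT, smul_smul, mul_assoc, inv_mul_cancel₀ hN0, mul_one]

end Center

end InfBraid

theorem mainTheorem9 {k : Type*} [Field k] [CharZero k] (n : ℕ) (hn : 2 ≤ n)
    {V : Type*} [AddCommGroup V] [Module k V] [FiniteDimensional k V]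
    (ρ : InfBraid.BraidAlg k n →ₐ[k] Module.End k V)
    (hpure : InfBraid.IsEssentiallyPure hn ρ) (hss : InfBraid.IsSemisimpleRep ρ) :
    LieAlgebra.HasCentralRadical k (InfBraid.imageLie ρ) ∧
    (LieAlgebra.center k (InfBraid.imageLie ρ)).toSubmodule.map
        (InfBraid.imageLie ρ).toSubmodule.subtype =
      (LieAlgebra.center k (InfBraid.PureLie k n)).toSubmodule.map
        (InfBraid.restrictPure ρ : InfBraid.PureLie k n →ₗ[k] Module.End k V) ∧
    (LieAlgebra.center k (InfBraid.PureLie k n)).toSubmodule.map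
        (InfBraid.restrictPure ρ : InfBraid.PureLie k n →ₗ[k] Module.End k V) =
      Submodule.span k {InfBraid.restrictPure ρ (InfBraid.sumT k n)} ∧
    (LinearMap.trace k V
        (InfBraid.restrictPure ρ (InfBraid.t k ⟨0, by omega⟩ ⟨1, by omega⟩)) ≠ 0 →
      Module.finrank k (LieAlgebra.center k (InfBraid.imageLie ρ)) = 1) ∧
    (InfBraid.IsAgregating ρ → InfBraid.IsSplitLie k (InfBraid.imageLie ρ)) := by
  have hc := InfBraid.complementedLattice_of_isSemisimpleRep hpure hss
  -- The equalities come from the cycle `Z(ℋ) ⊆ kT ⊆ ρ(Z(𝒯ₙ)) ⊆ Z(ℋ)`.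
  have h1 : (LieAlgebra.center k (InfBraid.imageLie ρ)).toSubmodule.map
      (InfBraid.imageLie ρ).toSubmodule.subtype ≤
      Submodule.span k {InfBraid.restrictPure ρ (InfBraid.sumT k n)} := by
    rintro - ⟨y, hy, rfl⟩
    obtain ⟨c, rfl⟩ := InfBraid.center_imageLie_le_span hpure hss hy
    exact Submodule.smul_mem _ c (Submodule.mem_span_singleton_self _)
  have h2 : Submodule.span k {InfBraid.restrictPure ρ (InfBraid.sumT k n)} ≤
      (LieAlgebra.center k (InfBraid.PureLie k n)).toSubmodule.map
        (InfBraid.restrictPure ρ : InfBraid.PureLie k n →ₗ[k] Module.End k V) := by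
    rw [Submodule.span_singleton_le_iff_mem]
    exact ⟨_, InfBraid.sumT_mem_center, rfl⟩
  have h3 : (LieAlgebra.center k (InfBraid.PureLie k n)).toSubmodule.map
        (InfBraid.restrictPure ρ : InfBraid.PureLie k n →ₗ[k] Module.End k V) ≤
      (LieAlgebra.center k (InfBraid.imageLie ρ)).toSubmodule.map
      (InfBraid.imageLie ρ).toSubmodule.subtype := by
    rintro - ⟨x, hx, rfl⟩
    exact ⟨InfBraid.toImageLie ρ x, InfBraid.toImageLie_mem_center hx, rfl⟩
  refine ⟨LieAlgebra.hasCentralRadical_of_complementedLattice k _ V,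
    le_antisymm (h1.trans h2) h3, le_antisymm (h3.trans h1) h2, fun htr => ?_, ?_⟩
  -- The `tᵢⱼ` with `i < j` are conjugate, so `tr T` is a positive integer multiple of `tr ρ(t₁₂)`.
  · have hT : InfBraid.restrictPure ρ (InfBraid.sumT k n) ≠ 0 := by
      intro h0
      have h := InfBraid.trace_restrictPure_sumT (ρ := ρ) hn
      rw [h0, map_zero, eq_comm, smul_eq_zero] at h
      exact htr (h.resolve_left (InfBraid.card_filter_lt_ne_zero hn))
    have hfin := Submodule.finrank_map_subtype_eq (InfBraid.imageLie ρ).toSubmodule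
      (LieAlgebra.center k (InfBraid.imageLie ρ)).toSubmodule
    rw [le_antisymm h1 (h2.trans h3), finrank_span_singleton hT] at hfin
    exact hfin.symm
  · rintro ⟨x, -, hx⟩
    exact InfBraid.isSplitLie_of_isRegularEnd _ (InfBraid.toImageLie ρ x) hx
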